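/- Fix $\eta>50$ and put $\alpha_1^*=0.002$, $\alpha_2^*=7$. For $n$ large let $(G_t)_{t\in\mathbb Z}$ be a sequence of independent Erdős–Rényi graphs on $[n]=\{1,\dots,n\}$ in which each edge is present with probability $p=\frac{\eta\log n}{n-1}$, and let $\mathbf P$ denote its law. Let $P_t$ be the transition matrix of the lazy simple random walk on $G_t$: for $x\ne y$, $P_t(x,y)=\frac1{2\deg_t(x)}$ if $x,y$ are adjacent in $G_t$ and $P_t(x,y)=0$ otherwise; $P_t(x,x)=\frac12$ if $\deg_t(x)\ge1$ and $P_t(x,x)=1$ if $\deg_t(x)=0$. Write $P^{s,t}=P_{s+1}\cdots P_t$ for $s<t$, and let $\pi_t(y)=\lim_{s\to-\infty}P^{s,t}(x,y)$ whenever this limit exists for all $x,y\in[n]$ and does not depend on $x$ (we then say that $\pi_t$ exists). For $A,B\subset[n]$ put $\pi_t(A)=\sum_{x\in A}\pi_t(x)$ and $Q_t(A,B)=\sum_{x\in A}\sum_{y\in B}\pi_{t-1}(x)P_t(x,y)$, and define $$g_t=\min_{z\in[n]}\frac{\pi_{t-1}(z)}{\pi_t(z)},\qquad \Phi_t(S)=\frac{Q_t(S,S^c)+Q_t(S^c,S)}{2\pi_{t-1}(S)},$$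 $$\Phi_t^*=\inf\Big\{\Phi_t(S):\emptyset\ne S\subset[n],\ \pi_{t-1}(S)\le\tfrac12\Big\},\qquad \Theta_t=\min_{1\le s\le t}\bigg(\frac12\,\frac{g_s}{1-\frac12 g_s}\,\Phi_s^*\bigg)^2,$$ with $\Theta_0=+\infty$ (empty minimum). Then $$\lim_{n\to\infty}\mathbf P\Bigg(\pi_t\text{ exists for all }t\in\mathbb Z,\ \text{ and }\ \Theta_t\ge\bigg(\frac{\alpha_1^*}{2\alpha_2^*-\alpha_1^*}\cdot\frac{\alpha_1^*}{32(\alpha_2^*)^2}\bigg)^2\ \text{ for all }t\in\{0,\dots,n\}\Bigg)=1.$$ -/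

import Mathlib

open MeasureTheory Filter Topology

noncomputable section

namespace DynamicGraph

/-- The product `P^{s,t} = P_{s+1} P_{s+2} ⋯ P_t` of a sequence of matrices indexed by `ℤ`
(the identity if `t ≤ s`). -/
def transitionProd {V : Type*} [Fintype V] [DecidableEq V]
    (P : ℤ → Matrix V V ℝ) (s t : ℤ) : Matrix V V ℝ :=
  ((List.range (t - s).toNat).map fun k : ℕ => P (s + 1 + (k : ℤ))).prod

/-- `μ` is the target distribution at time `t`: for every starting state `x`,
`P^{s,t}(x, ·) → μ` as `s → -∞`, the limit being the same for all `x`. -/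
def IsTarget {V : Type*} [Fintype V] [DecidableEq V]
    (P : ℤ → Matrix V V ℝ) (t : ℤ) (μ : V → ℝ) : Prop :=
  ∀ x y : V, Tendsto (fun s : ℤ => transitionProd P s t x y) atBot (𝓝 (μ y))

/-- The statement that the target distribution `π_t` exists. -/
def TargetExists {V : Type*} [Fintype V] [DecidableEq V]
    (P : ℤ → Matrix V V ℝ) (t : ℤ) : Prop :=
  ∃ μ : V → ℝ, IsTarget P t μ

open Classical in
/-- The target distribution `π_t` (with the value `0` if it does not exist). -/
def target {V : Type*} [Fintype V] [DecidableEq V]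
    (P : ℤ → Matrix V V ℝ) (t : ℤ) : V → ℝ :=
  if h : TargetExists P t then h.choose else 0

/-- `π_t(S)`. -/
def targetMass {V : Type*} [Fintype V] [DecidableEq V]
    (P : ℤ → Matrix V V ℝ) (t : ℤ) (S : Finset V) : ℝ :=
  ∑ x ∈ S, target P t x

/-- The stationary flow `Q_t(A, B) = ∑_{x ∈ A} ∑_{y ∈ B} π_{t-1}(x) P_t(x, y)` from `A` to `B`
between the times `t - 1` and `t`. -/
def flow {V : Type*} [Fintype V] [DecidableEq V]
    (P : ℤ → Matrix V V ℝ) (t : ℤ) (A B : Finset V) : ℝ :=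
  ∑ y ∈ B, ∑ x ∈ A, target P (t - 1) x * P t x y

/-- `Φ_t(S) = (Q_t(S, Sᶜ) + Q_t(Sᶜ, S)) / (2 π_{t-1}(S))`. -/
def bottleneck {V : Type*} [Fintype V] [DecidableEq V]
    (P : ℤ → Matrix V V ℝ) (t : ℤ) (S : Finset V) : ℝ :=
  1 / (2 * targetMass P (t - 1) S) * (flow P t S Sᶜ + flow P t Sᶜ S)

/-- The time-dependent bottleneck ratio `Φ*_t`, the infimum of `Φ_t(S)` over the nonempty sets `S`
with `π_{t-1}(S) ≤ 1/2`. -/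
def bottleneckRatio {V : Type*} [Fintype V] [DecidableEq V]
    (P : ℤ → Matrix V V ℝ) (t : ℤ) : ℝ :=
  sInf {r : ℝ | ∃ S : Finset V, S.Nonempty ∧ targetMass P (t - 1) S ≤ 1 / 2 ∧
    r = bottleneck P t S}

/-- `g_t = min_z π_{t-1}(z) / π_t(z)`. -/
def changeRate {V : Type*} [Fintype V] [DecidableEq V]
    (P : ℤ → Matrix V V ℝ) (t : ℤ) : ℝ :=
  ⨅ z : V, target P (t - 1) z / target P t z

/-- `Θ_t = min_{1 ≤ s ≤ t} ((1/2) g_s / (1 - (1/2) g_s) * Φ*_s) ^ 2`. The values are extended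
reals, so that the empty minimum at `t = 0` is `+∞`. -/
def Theta {V : Type*} [Fintype V] [DecidableEq V]
    (P : ℤ → Matrix V V ℝ) (t : ℤ) : EReal :=
  ⨅ s ∈ Set.Icc (1 : ℤ) t,
    ((((1 / 2) * (changeRate P s / (1 - (1 / 2) * changeRate P s)) * bottleneckRatio P s) ^ 2 : ℝ)
      : EReal)

open Classical in
/-- The transition matrix of the lazy simple random walk on a finite graph; the walk does not move
from an isolated vertex. -/
def lazyWalk {V : Type*} [Fintype V] (G : SimpleGraph V) : Matrix V V ℝ :=
  Matrix.of fun x y =>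
    if x = y then (if 1 ≤ G.degree x then 1 / 2 else 1)
    else if G.Adj x y then 1 / (2 * (G.degree x : ℝ)) else 0

/-- The law of the dynamic Erdős–Rényi model: a sequence `(G_t)`, `t ∈ ℤ`, of independent binomial
random graphs on `n` vertices with edge probability `p`. -/
def dynamicER (n : ℕ) (p : unitInterval) : Measure (ℤ → SimpleGraph (Fin n)) :=
  Measure.infinitePi fun _ : ℤ => SimpleGraph.binomialRandom (Fin n) p

end DynamicGraph

end

namespace DynamicGraph

/-! With L = η log n, everything follows from two-sided bounds on `target`: with probability at
least 1 - 12/n, every π_t with 0 ≤ t ≤ n takes values in [0.035/n, 7/n].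

Existence is almost sure. The complete graph occurs at arbitrarily negative times, each occurrence
contracts the oscillation of the columns of P^{s,t} by a fixed factor, and so the columns converge
to constants.

For the bounds, run the walk from x₀ at time -k. At time -n its law ν has masses at most 1 = n/n. If
ν ≤ R/n with R ≥ 7, the next graph is independent of ν, and Chernoff bounds show that the neighbours
of every vertex carry ν-mass at most 0.4LR/n. Since degrees are at least L/2, one step turns the
bound R/n into (1/2 + 0.4)R/n. After n - 1 steps the bound has reached 7/n. From then on a lower
tail also applies and, with degrees at most 2L, gives masses at least 0.14/(4n) = 0.035/n. The
failure probability is at most 12/n for each k, hence also for failure at all large k. Otherwise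
infinitely many k are good, and the limit inherits the bounds.

The bounds give g_s ≥ 0.035/7. Combined with edge expansion (cuts of size at least L|S|/10), they
give Φ*_s ≥ 0.035/(4·70). The product of these is far above the required constant.

Main lemmas: `measureReal_not_goodStep`, `infinitePi_real_mem_le`,
`targetExists_of_frequently_positive`, `le_Theta`, `le_dynamicER_Theta`. -/

instance {V : Type*} [Finite V] : MeasurableSingletonClass (SimpleGraph V) where
  measurableSet_singleton G := by
    have h : ({G} : Set (SimpleGraph V)) = SimpleGraph.edgeSet ⁻¹' {G.edgeSet} := by
      ext H
      simp
    rw [h]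
    exact SimpleGraph.measurable_edgeSet (measurableSet_singleton _)

/-! ### Chernoff bounds for weighted edge counts -/

section BinomialTails

open ProbabilityTheory unitInterval
open scoped ENNReal Classical

variable {V : Type*} [Fintype V] {ι : Type*} [Fintype ι]

/-- The exponential moments of a binomial random graph factorise over distinct edges. -/
lemma lintegral_binomialRandom_prod (p : I) {e : ι → Sym2 V} (he : Function.Injective e)
    (hd : ∀ i, ¬ (e i).IsDiag) (z : ι → ℝ≥0∞) :
    ∫⁻ G, ∏ i, (if e i ∈ G.edgeSet then z i else 1) ∂(SimpleGraph.binomialRandom V p) =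
      ∏ i, ((toNNReal p : ℝ≥0∞) * z i + (toNNReal (σ p) : ℝ≥0∞)) := by
  have hX : iIndepFun (fun (a : Sym2 V) (ω : Sym2 V → Prop) => ω a)
      (Measure.infinitePi fun a : Sym2 V =>
        (toNNReal p • Measure.dirac (a ∈ Sym2.diagSetᶜ) +
          toNNReal (σ p) • Measure.dirac False : Measure Prop)) :=
    iIndepFun_infinitePi (X := fun _ b => b) (fun _ => measurable_id)
  have hY : iIndepFun (fun (i : ι) (ω : Sym2 V → Prop) => if ω (e i) then z i else 1)
      (Measure.infinitePi fun a : Sym2 V =>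
        (toNNReal p • Measure.dirac (a ∈ Sym2.diagSetᶜ) +
          toNNReal (σ p) • Measure.dirac False : Measure Prop)) :=
    (hX.precomp he).comp (fun i b => if b then z i else 1) fun _ => measurable_of_finite _
  obtain ⟨F, hF⟩ : ∃ F : SimpleGraph V → ℝ≥0∞,
      F = fun G => ∏ i, (if e i ∈ G.edgeSet then z i else 1) := ⟨_, rfl⟩
  have h1 : ∀ ω : Sym2 V → Prop,
      F (SimpleGraph.fromEdgeSet {a | ω a}) = ∏ i, (if ω (e i) then z i else 1) := by
    intro ω
    rw [hF]
    refine Finset.prod_congr rfl fun i _ => ?_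
    have := hd i
    simp [SimpleGraph.edgeSet_fromEdgeSet, this]
  have hm : Measurable fun S : Set (Sym2 V) => F (SimpleGraph.fromEdgeSet S) :=
    measurable_of_finite _
  rw [← hF, SimpleGraph.binomialRandom_eq_map,
    lintegral_map (measurable_of_finite F) (by fun_prop), setBernoulli_eq_map,
    lintegral_map hm (by fun_prop)]
  simp_rw [h1]
  rw [lintegral_prod_eq_prod_lintegral_of_indepFun _ _ hY fun i =>
    (measurable_of_finite fun b : Prop => if b then z i else 1).comp (measurable_pi_apply (e i))]
  refine Finset.prod_congr rfl fun i _ => ?_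
  rw [(measurePreserving_eval_infinitePi (fun a : Sym2 V =>
        (toNNReal p • Measure.dirac (a ∈ Sym2.diagSetᶜ) +
          toNNReal (σ p) • Measure.dirac False : Measure Prop)) (e i)).lintegral_comp
      (measurable_of_finite fun b : Prop => if b then z i else 1),
    lintegral_add_measure, lintegral_smul_measure, lintegral_smul_measure,
    lintegral_dirac, lintegral_dirac]
  have := hd i
  simp [this, ENNReal.smul_def]

/-- The Chernoff bound for a weighted sum of edge indicators. -/
lemma binomialRandom_exp_tail (p : I) {e : ι → Sym2 V} (he : Function.Injective e)
    (hd : ∀ i, ¬ (e i).IsDiag) (w : ι → ℝ) (a : ℝ) :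
    SimpleGraph.binomialRandom V p {G | a ≤ ∑ i, if e i ∈ G.edgeSet then w i else 0} ≤
      ENNReal.ofReal (Real.exp ((p : ℝ) * ∑ i, (Real.exp (w i) - 1) - a)) := by
  have hp0 : (0 : ℝ) ≤ p := p.2.1
  have hp1 : (p : ℝ) ≤ 1 := p.2.2
  have key : ∫⁻ G, ENNReal.ofReal (Real.exp (∑ i, if e i ∈ G.edgeSet then w i else 0))
      ∂(SimpleGraph.binomialRandom V p) ≤
      ENNReal.ofReal (Real.exp ((p : ℝ) * ∑ i, (Real.exp (w i) - 1))) := by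
    have h2 : ∀ G : SimpleGraph V,
        ENNReal.ofReal (Real.exp (∑ i, if e i ∈ G.edgeSet then w i else 0)) =
        ∏ i, (if e i ∈ G.edgeSet then ENNReal.ofReal (Real.exp (w i)) else 1) := by
      intro G
      rw [Real.exp_sum, ENNReal.ofReal_prod_of_nonneg fun i _ => (Real.exp_pos _).le]
      refine Finset.prod_congr rfl fun i _ => ?_
      split_ifs <;> simp
    simp_rw [h2]
    rw [lintegral_binomialRandom_prod p he hd, Finset.mul_sum, Real.exp_sum,
      ENNReal.ofReal_prod_of_nonneg fun i _ => (Real.exp_pos _).le]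
    refine Finset.prod_le_prod' fun i _ => ?_
    have h3 : ((toNNReal p : NNReal) : ℝ≥0∞) = ENNReal.ofReal p := by
      rw [ENNReal.ofReal, ENNReal.coe_inj]; ext; simp [hp0]
    have h4 : ((toNNReal (σ p) : NNReal) : ℝ≥0∞) = ENNReal.ofReal (1 - p) := by
      rw [ENNReal.ofReal, ENNReal.coe_inj]; ext; simp [hp1]
    rw [h3, h4, ← ENNReal.ofReal_mul hp0,
      ← ENNReal.ofReal_add (by positivity) (by linarith)]
    refine ENNReal.ofReal_le_ofReal ?_
    have := Real.add_one_le_exp ((p : ℝ) * (Real.exp (w i) - 1))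
    linarith
  have h5 := meas_ge_le_lintegral_div (μ := SimpleGraph.binomialRandom V p)
    (f := fun G => ENNReal.ofReal (Real.exp (∑ i, if e i ∈ G.edgeSet then w i else 0)))
    (measurable_of_finite _).aemeasurable (ε := ENNReal.ofReal (Real.exp a))
    (by simp [Real.exp_pos]) (by simp)
  have h6 : {G : SimpleGraph V | a ≤ ∑ i, if e i ∈ G.edgeSet then w i else 0} ⊆
      {G | ENNReal.ofReal (Real.exp a) ≤
        ENNReal.ofReal (Real.exp (∑ i, if e i ∈ G.edgeSet then w i else 0))} := by
    intro G hG
    exact ENNReal.ofReal_le_ofReal (Real.exp_le_exp.2 hG)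
  refine (measure_mono h6).trans (h5.trans ((ENNReal.div_le_div_right key _).trans ?_))
  rw [← ENNReal.ofReal_div_of_pos (Real.exp_pos _), ← Real.exp_sub]

/-- The chord of the exponential over [0, 1] has slope e - 1 < 1.72. Likewise 0.63 < 1 - 1/e in the
next lemma. These are the Chernoff constants with the exponential parameter fixed at 1. -/
lemma exp_sub_one_le_of_mem_Icc {w : ℝ} (h0 : 0 ≤ w) (h1 : w ≤ 1) :
    Real.exp w - 1 ≤ 1.72 * w := by
  have h := convexOn_exp.2 (Set.mem_univ 0) (Set.mem_univ 1) (sub_nonneg.2 h1) h0 (by ring)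
  have := Real.exp_one_lt_d9
  simp only [smul_eq_mul, mul_zero, mul_one, zero_add, Real.exp_zero] at h
  nlinarith

lemma exp_neg_sub_one_le_of_mem_Icc {w : ℝ} (h0 : 0 ≤ w) (h1 : w ≤ 1) :
    Real.exp (-w) - 1 ≤ -(0.63 * w) := by
  have h := convexOn_exp.2 (Set.mem_univ 0) (Set.mem_univ (-1)) (sub_nonneg.2 h1) h0 (by ring)
  have := Real.exp_neg_one_lt_d9
  simp only [smul_eq_mul, mul_zero, mul_neg, mul_one, zero_add, Real.exp_zero] at h
  nlinarith

lemma binomialRandom_upper_tail (p : I) {e : ι → Sym2 V} (he : Function.Injective e)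
    (hd : ∀ i, ¬ (e i).IsDiag) {w : ι → ℝ} (h0 : ∀ i, 0 ≤ w i) (h1 : ∀ i, w i ≤ 1) (a : ℝ) :
    SimpleGraph.binomialRandom V p {G | a ≤ ∑ i, if e i ∈ G.edgeSet then w i else 0} ≤
      ENNReal.ofReal (Real.exp (1.72 * (p * ∑ i, w i) - a)) := by
  refine (binomialRandom_exp_tail p he hd w a).trans
    (ENNReal.ofReal_le_ofReal (Real.exp_le_exp.2 ?_))
  have h : ∑ i, (Real.exp (w i) - 1) ≤ 1.72 * ∑ i, w i := by
    rw [Finset.mul_sum]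
    exact Finset.sum_le_sum fun i _ => exp_sub_one_le_of_mem_Icc (h0 i) (h1 i)
  have := mul_le_mul_of_nonneg_left h p.2.1
  linarith

lemma binomialRandom_lower_tail (p : I) {e : ι → Sym2 V} (he : Function.Injective e)
    (hd : ∀ i, ¬ (e i).IsDiag) {w : ι → ℝ} (h0 : ∀ i, 0 ≤ w i) (h1 : ∀ i, w i ≤ 1) (a : ℝ) :
    SimpleGraph.binomialRandom V p {G | ∑ i, (if e i ∈ G.edgeSet then w i else 0) ≤ a} ≤
      ENNReal.ofReal (Real.exp (a - 0.63 * (p * ∑ i, w i))) := by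
  have h2 : {G : SimpleGraph V | ∑ i, (if e i ∈ G.edgeSet then w i else 0) ≤ a} =
      {G | -a ≤ ∑ i, if e i ∈ G.edgeSet then (-w i) else 0} := by
    ext G
    have : (∑ i, if e i ∈ G.edgeSet then (-w i) else 0) =
        -∑ i, (if e i ∈ G.edgeSet then w i else 0) := by
      rw [← Finset.sum_neg_distrib]
      exact Finset.sum_congr rfl fun i _ => by split_ifs <;> simp
    simp only [Set.mem_ofPred_eq]
    rw [this, neg_le_neg_iff]
  rw [h2]
  refine (binomialRandom_exp_tail p he hd (fun i => -w i) (-a)).trans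
    (ENNReal.ofReal_le_ofReal (Real.exp_le_exp.2 ?_))
  have h : ∑ i, (Real.exp (-w i) - 1) ≤ -(0.63 * ∑ i, w i) := by
    rw [Finset.mul_sum, ← Finset.sum_neg_distrib]
    exact Finset.sum_le_sum fun i _ => exp_neg_sub_one_le_of_mem_Icc (h0 i) (h1 i)
  have := mul_le_mul_of_nonneg_left h p.2.1
  linarith

end BinomialTails

/-! ### Degrees, expansion and spreading in one random graph -/

section GraphEvents

open unitInterval
open scoped Classical

/-- The total weight of the neighbours of `y`. -/
noncomputable def nbrSum {V : Type*} [Fintype V] (G : SimpleGraph V) (w : V → ℝ) (y : V) : ℝ :=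
  ∑ x, if G.Adj y x then w x else 0

/-- The number of edges between `S` and its complement. -/
noncomputable def cutSize {V : Type*} [Fintype V] [DecidableEq V] (G : SimpleGraph V) (S : Finset V) : ℝ :=
  ∑ x ∈ S, ∑ y ∈ Sᶜ, if G.Adj x y then 1 else 0

/-- All degrees of `G` are comparable to `L` and `G` expands small sets. -/
def GoodGraph (n : ℕ) (L : ℝ) (G : SimpleGraph (Fin n)) : Prop :=
  (∀ x, L / 2 ≤ nbrSum G (fun _ => 1) x ∧ nbrSum G (fun _ => 1) x ≤ 2 * L) ∧
    ∀ S : Finset (Fin n), S.Nonempty → 2 * S.card ≤ n → L * S.card / 10 ≤ cutSize G S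

/-- The neighbourhoods of `G` spread the mass distribution `ν`, which is bounded by `R / n`. -/
def GoodStep (n : ℕ) (L R : ℝ) (ν : Fin n → ℝ) (G : SimpleGraph (Fin n)) : Prop :=
  ∀ y, nbrSum G ν y ≤ 0.4 * L * R / n ∧ (R = 7 → 0.14 * L / n ≤ nbrSum G ν y)

lemma nbrSum_eq_sum_ne {V : Type*} [Fintype V] (G : SimpleGraph V) (w : V → ℝ) (y : V) :
    nbrSum G w y = ∑ x : {x // x ≠ y}, if s(y, (x : V)) ∈ G.edgeSet then w x else 0 := by
  rw [nbrSum, ← Finset.sum_subtype (Finset.univ.filter (· ≠ y)) (by simp)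
    fun x => if s(y, x) ∈ G.edgeSet then w x else 0, Finset.sum_filter_of_ne]
  · simp
  · rintro x - hx rfl
    simp at hx

lemma nbrSum_smul {V : Type*} [Fintype V] (G : SimpleGraph V) (c : ℝ) (w : V → ℝ) (y : V) :
    nbrSum G (fun x => c * w x) y = c * nbrSum G w y := by
  simp only [nbrSum, Finset.mul_sum, mul_ite, mul_zero]

variable {n : ℕ} (p : I)

lemma nbr_edge_injective {V : Type*} (y : V) :
    Function.Injective fun x : {x // x ≠ y} => s(y, (x : V)) := by
  intro a b h
  exact Subtype.ext (Sym2.congr_right.1 h)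

lemma measureReal_nbrSum_ge {w : Fin n → ℝ} (h0 : ∀ x, 0 ≤ w x) (h1 : ∀ x, w x ≤ 1)
    (y : Fin n) (a : ℝ) :
    (SimpleGraph.binomialRandom (Fin n) p).real {G | a ≤ nbrSum G w y} ≤
      Real.exp (1.72 * (p * ∑ x, w x) - a) := by
  simp_rw [nbrSum_eq_sum_ne]
  have htail := ENNReal.toReal_le_of_le_ofReal (Real.exp_pos _).le
    (binomialRandom_upper_tail p (nbr_edge_injective y) (fun x => by simpa using x.2.symm)
      (fun x => h0 x) (fun x => h1 x) a)
  refine (le_of_eq ?_).trans (htail.trans (Real.exp_le_exp.2 ?_))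
  · rw [measureReal_def]
    congr!
  have h : ∑ x : {x // x ≠ y}, w x ≤ ∑ x, w x := by
    rw [← Finset.sum_subtype (Finset.univ.filter (· ≠ y)) (by simp) w]
    exact Finset.sum_le_univ_sum_of_nonneg h0
  have := mul_le_mul_of_nonneg_left h p.2.1
  linarith

/-- The vertex `y` is not its own neighbour, which costs at most 1 in the total weight. -/
lemma measureReal_nbrSum_le {w : Fin n → ℝ} (h0 : ∀ x, 0 ≤ w x) (h1 : ∀ x, w x ≤ 1)
    (y : Fin n) (a : ℝ) :
    (SimpleGraph.binomialRandom (Fin n) p).real {G | nbrSum G w y ≤ a} ≤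
      Real.exp (a - 0.63 * (p * (∑ x, w x - 1))) := by
  simp_rw [nbrSum_eq_sum_ne]
  have htail := ENNReal.toReal_le_of_le_ofReal (Real.exp_pos _).le
    (binomialRandom_lower_tail p (nbr_edge_injective y) (fun x => by simpa using x.2.symm)
      (fun x => h0 x) (fun x => h1 x) a)
  refine (le_of_eq ?_).trans (htail.trans (Real.exp_le_exp.2 ?_))
  · rw [measureReal_def]
    congr!
  have h : ∑ x, w x - 1 ≤ ∑ x : {x // x ≠ y}, w x := by
    rw [← Finset.sum_subtype (Finset.univ.erase y) (by simp) w,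
      ← Finset.add_sum_erase _ w (Finset.mem_univ y)]
    linarith [h1 y]
  have := mul_le_mul_of_nonneg_left h p.2.1
  linarith

lemma measureReal_cutSize_le (S : Finset (Fin n)) (a : ℝ) :
    (SimpleGraph.binomialRandom (Fin n) p).real {G | cutSize G S ≤ a} ≤
      Real.exp (a - 0.63 * (p * (S.card * (n - S.card)))) := by
  have hcut : ∀ G : SimpleGraph (Fin n), cutSize G S = ∑ i : S × (Sᶜ : Finset (Fin n)),
      if s((i.1 : Fin n), (i.2 : Fin n)) ∈ G.edgeSet then (1 : ℝ) else 0 := by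
    intro G
    rw [cutSize, ← Finset.sum_coe_sort, Fintype.sum_prod_type]
    refine Finset.sum_congr rfl fun x _ => ?_
    rw [← Finset.sum_coe_sort]
    rfl
  have hinj : Function.Injective fun i : S × (Sᶜ : Finset (Fin n)) =>
      s((i.1 : Fin n), (i.2 : Fin n)) := by
    rintro ⟨⟨a, ha⟩, b, hb⟩ ⟨⟨c, hc⟩, d, hd⟩ h
    rw [Finset.mem_compl] at hb hd
    simp only [Sym2.eq_iff] at h
    rcases h with ⟨rfl, rfl⟩ | ⟨rfl, rfl⟩
    · rfl
    · exact absurd ha hd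
  simp_rw [hcut]
  refine (ENNReal.toReal_le_of_le_ofReal (Real.exp_pos _).le
    (binomialRandom_lower_tail p hinj ?_ (fun _ => zero_le_one) (fun _ => le_rfl) a)).trans
      (Real.exp_le_exp.2 ?_)
  · rintro ⟨⟨a, ha⟩, b, hb⟩ h
    rw [Finset.mem_compl] at hb
    simp only [Sym2.mk_isDiag_iff] at h
    exact hb (h ▸ ha)
  · have : ((Sᶜ : Finset (Fin n)).card : ℝ) = n - S.card := by
      rw [Finset.card_compl, Nat.cast_sub (Finset.card_le_univ S), Fintype.card_fin]
    simp only [Finset.sum_const, Finset.card_univ, Fintype.card_prod, Fintype.card_coe,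
      nsmul_eq_mul, mul_one, Nat.cast_mul, this, le_refl]

lemma exp_le_inv_pow {n : ℕ} (hn : 0 < n) {x : ℝ} (k : ℕ) (hx : x ≤ -(k * Real.log n)) :
    Real.exp x ≤ 1 / (n : ℝ) ^ k := by
  have hn' : (0 : ℝ) < n := by exact_mod_cast hn
  calc Real.exp x ≤ Real.exp (-(k * Real.log n)) := Real.exp_le_exp.2 hx
    _ = 1 / (n : ℝ) ^ k := by
      rw [Real.exp_neg, Real.exp_nat_mul, Real.exp_log hn', one_div]

lemma measureReal_exists_le {Ω ι : Type*} [MeasurableSpace Ω] [Fintype ι] (μ : Measure Ω)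
    [IsFiniteMeasure μ] {P : ι → Ω → Prop} {c : ι → ℝ} (h : ∀ i, μ.real {ω | P i ω} ≤ c i) :
    μ.real {ω | ∃ i, P i ω} ≤ ∑ i, c i := by
  rw [Set.ofPred_exists]
  exact (measureReal_iUnion_fintype_le _).trans (Finset.sum_le_sum fun i _ => h i)

lemma measureReal_or_le {Ω : Type*} [MeasurableSpace Ω] (μ : Measure Ω)
    [IsFiniteMeasure μ] {P Q : Ω → Prop} {a b : ℝ} (hP : μ.real {ω | P ω} ≤ a)
    (hQ : μ.real {ω | Q ω} ≤ b) : μ.real {ω | P ω ∨ Q ω} ≤ a + b := by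
  rw [Set.ofPred_or]
  exact (measureReal_union_le _ _).trans (add_le_add hP hQ)

variable {L : ℝ}

lemma measureReal_degree (hn : 400 ≤ n) (hL : (p : ℝ) * (n - 1) = L)
    (hlog : 50 * Real.log n ≤ L) :
    (SimpleGraph.binomialRandom (Fin n) p).real {G | ∃ x : Fin n,
      nbrSum G (fun _ => 1) x ≤ L / 2 ∨ 2 * L ≤ nbrSum G (fun _ => 1) x} ≤ 2 / (n : ℝ) ^ 2 := by
  have hn0 : 0 < n := by omega
  have hn' : (400 : ℝ) ≤ n := by exact_mod_cast hn
  have hp0 : (0 : ℝ) ≤ p := p.2.1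
  have hp1 : (p : ℝ) ≤ 1 := p.2.2
  have hlog1 : 1 ≤ Real.log n := by
    rw [Real.le_log_iff_exp_le (by linarith)]
    linarith [Real.exp_one_lt_d9]
  refine (measureReal_exists_le _ (c := fun _ => 1 / (n : ℝ) ^ 3 + 1 / (n : ℝ) ^ 3)
    fun x => measureReal_or_le _ ?_ ?_).trans ?_
  · refine (measureReal_nbrSum_le p (fun _ => zero_le_one) (fun _ => le_rfl) x _).trans
      (exp_le_inv_pow hn0 3 ?_)
    simp
    rw [hL]
    linarith
  · refine (measureReal_nbrSum_ge p (fun _ => zero_le_one) (fun _ => le_rfl) x _).trans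
      (exp_le_inv_pow hn0 3 ?_)
    simp
    linarith
  · simp only [Finset.sum_const, Finset.card_univ, Fintype.card_fin, nsmul_eq_mul]
    apply le_of_eq
    field_simp
    ring

/-- The cut of S has mean p|S|(n - |S|) ≥ L|S|/2, so S fails with probability at most q^|S|, where q
= n⁻⁴. The binomial theorem sums these bounds over nonempty S to (1 + q)^n - 1, which is of order
n⁻³. -/
lemma measureReal_cut (hn : 400 ≤ n) (hL : (p : ℝ) * (n - 1) = L)
    (hlog : 50 * Real.log n ≤ L) :
    (SimpleGraph.binomialRandom (Fin n) p).real {G | ∃ S : Finset (Fin n),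
      S.Nonempty ∧ 2 * S.card ≤ n ∧ cutSize G S ≤ L * S.card / 10} ≤ 2 / (n : ℝ) ^ 2 := by
  have hn0 : 0 < n := by omega
  have hn' : (400 : ℝ) ≤ n := by exact_mod_cast hn
  have hlog0 : 0 ≤ Real.log n := Real.log_nonneg (by linarith)
  have hp0 : (0 : ℝ) ≤ p := p.2.1
  set q : ℝ := 1 / (n : ℝ) ^ 4 with hq
  have hq0 : 0 ≤ q := by positivity
  refine (measureReal_exists_le _
    (c := fun S : Finset (Fin n) => if S = ∅ then 0 else q ^ S.card) fun S => ?_).trans ?_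
  · split_ifs with hS
    · simp [hS]
    · by_cases hc : 2 * S.card ≤ n
      · have hc' : (2 : ℝ) * S.card ≤ n := by exact_mod_cast hc
        have hS0 : (0 : ℝ) ≤ S.card := by positivity
        refine (measureReal_mono (s₂ := {G | cutSize G S ≤ L * S.card / 10})
          fun G hG => hG.2.2).trans
          ((measureReal_cutSize_le p S (L * S.card / 10)).trans ?_)
        rw [hq, one_div_pow, ← pow_mul]
        refine exp_le_inv_pow hn0 _ ?_
        have h1 : L ≤ 2 * (p * (n - S.card)) := by
          rw [← hL]; nlinarith
        have h2 : L * S.card ≤ 2 * (p * (S.card * (n - S.card))) := by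
          have := mul_le_mul_of_nonneg_right h1 hS0
          linarith
        have h3 := mul_le_mul_of_nonneg_right hlog hS0
        have h4 : 0 ≤ Real.log n * S.card := by positivity
        push_cast
        linarith
      · simp only [hc, false_and, and_false]
        simpa using pow_nonneg hq0 _
  · have h1 : ∑ S : Finset (Fin n), (if S = ∅ then 0 else q ^ S.card) = (q + 1) ^ n - 1 := by
      have h2 := Fin.sum_pow_mul_eq_add_pow (n := n) q 1
      simp only [one_pow, mul_one] at h2
      rw [← h2, ← Finset.add_sum_erase _ _ (Finset.mem_univ ∅),
        ← Finset.add_sum_erase (Finset.univ : Finset (Finset (Fin n))) _ (Finset.mem_univ ∅)]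
      simp only [if_true, Finset.card_empty, pow_zero, zero_add, add_sub_cancel_left]
      exact Finset.sum_congr rfl fun S hS => by rw [if_neg (Finset.ne_of_mem_erase hS)]
    rw [h1]
    have hnq : (n : ℝ) * q = 1 / (n : ℝ) ^ 3 := by
      rw [hq]; field_simp
    have hnq1 : (n : ℝ) * q ≤ 1 / (n : ℝ) ^ 2 := by
      rw [hnq]
      exact one_div_le_one_div_of_le (by positivity) (pow_le_pow_right₀ (by linarith) (by norm_num))
    have hnq2 : (n : ℝ) * q ≤ 1 := by
      refine hnq1.trans ?_
      rw [div_le_one (by positivity)]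
      exact one_le_pow₀ (by linarith)
    have h3 : (q + 1) ^ n ≤ Real.exp (n * q) := by
      rw [Real.exp_nat_mul]
      exact pow_le_pow_left₀ (by linarith) (Real.add_one_le_exp q) n
    have h4 := Real.abs_exp_sub_one_le (x := n * q) (by rw [abs_of_nonneg (by positivity)]; exact hnq2)
    rw [abs_of_nonneg (show 0 ≤ (n : ℝ) * q by positivity)] at h4
    have h5 := le_of_abs_le h4
    have h6 : (2 : ℝ) / (n : ℝ) ^ 2 = 2 * (1 / (n : ℝ) ^ 2) := by ring
    rw [h6]
    linarith

lemma measureReal_not_goodGraph (hn : 400 ≤ n) (hL : (p : ℝ) * (n - 1) = L)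
    (hlog : 50 * Real.log n ≤ L) :
    (SimpleGraph.binomialRandom (Fin n) p).real {G | ¬ GoodGraph n L G} ≤ 4 / (n : ℝ) ^ 2 := by
  have h := measureReal_or_le _ (measureReal_degree p hn hL hlog) (measureReal_cut p hn hL hlog)
  refine (measureReal_mono fun G hG => ?_).trans (h.trans (le_of_eq (by ring)))
  by_contra hcon
  simp only [Set.mem_ofPred_eq, not_or, not_exists, not_and, not_le] at hcon
  exact hG ⟨fun x => ⟨(hcon.1 x).1.le, (hcon.1 x).2.le⟩,
    fun S hS hS' => (hcon.2 S hS hS').le⟩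

/-- Rescaling ν by n/R gives weights in [0, 1] of total n/R, so the Chernoff exponents are multiples
of L. Each tail is at most n⁻³, which leaves room for unions over n vertices and 2n times. -/
lemma measureReal_not_goodStep (hn : 400 ≤ n) (hL : (p : ℝ) * (n - 1) = L)
    (hlog : 50 * Real.log n ≤ L) {R : ℝ} (hR : 7 ≤ R) {ν : Fin n → ℝ} (h0 : ∀ x, 0 ≤ ν x)
    (h1 : ∀ x, ν x ≤ R / n) (hsum : ∑ x, ν x = 1) :
    (SimpleGraph.binomialRandom (Fin n) p).real {G | ¬ GoodStep n L R ν G} ≤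
      2 / (n : ℝ) ^ 2 := by
  have hn0 : 0 < n := by omega
  have hn' : (400 : ℝ) ≤ n := by exact_mod_cast hn
  have hnpos : (0 : ℝ) < n := by linarith
  have hRpos : 0 < R := by linarith
  have hlog1 : 1 ≤ Real.log n := by
    rw [Real.le_log_iff_exp_le (by linarith)]
    linarith [Real.exp_one_lt_d9]
  have hp0 : (0 : ℝ) ≤ p := p.2.1
  have hw0 : ∀ x, 0 ≤ (n / R) * ν x := fun x => mul_nonneg (by positivity) (h0 x)
  have hw1 : ∀ x, (n / R) * ν x ≤ 1 := fun x => by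
    calc (n / R) * ν x ≤ (n / R) * (R / n) := mul_le_mul_of_nonneg_left (h1 x) (by positivity)
      _ = 1 := by field_simp
  have hws : ∑ x, (n / R) * ν x = n / R := by rw [← Finset.mul_sum, hsum, mul_one]
  have hpn : (p : ℝ) * n ≤ 1.01 * L := by rw [← hL]; nlinarith
  have hup : ∀ y, (SimpleGraph.binomialRandom (Fin n) p).real
      {G | 0.4 * L * R / n ≤ nbrSum G ν y} ≤ 1 / (n : ℝ) ^ 3 := by
    intro y
    have hset : {G : SimpleGraph (Fin n) | 0.4 * L * R / n ≤ nbrSum G ν y} =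
        {G | 0.4 * L ≤ nbrSum G (fun x => (n / R) * ν x) y} := by
      ext G
      simp only [Set.mem_ofPred_eq]
      rw [nbrSum_smul, div_mul_eq_mul_div, div_le_iff₀ hnpos, le_div_iff₀ hRpos, mul_comm (n : ℝ)]
    rw [hset]
    refine (measureReal_nbrSum_ge p hw0 hw1 y _).trans (exp_le_inv_pow hn0 3 ?_)
    rw [hws]
    -- R ≥ 7 makes 1.72 · 1.01/7 < 0.4.
    have h2 : (p : ℝ) * (n / R) ≤ 1.01 * L / 7 := by
      rw [← mul_div_assoc]
      exact div_le_div₀ (by linarith) hpn (by norm_num) hR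
    push_cast
    linarith
  -- For large R the total rescaled weight n/R is too small for such a lower tail, so it is claimed
  -- only at the terminal value of R.
  have hlow : R = 7 → ∀ y, (SimpleGraph.binomialRandom (Fin n) p).real
      {G | nbrSum G ν y ≤ 0.14 * L / n} ≤ 1 / (n : ℝ) ^ 3 := by
    intro hR7 y
    have hset : {G : SimpleGraph (Fin n) | nbrSum G ν y ≤ 0.14 * L / n} =
        {G | nbrSum G (fun x => (n / R) * ν x) y ≤ 0.02 * L} := by
      ext G
      simp only [Set.mem_ofPred_eq]
      rw [nbrSum_smul, div_mul_eq_mul_div, le_div_iff₀ hnpos, div_le_iff₀ hRpos, hR7,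
        mul_comm (n : ℝ)]
      ring_nf
    rw [hset]
    refine (measureReal_nbrSum_le p hw0 hw1 y _).trans (exp_le_inv_pow hn0 3 ?_)
    rw [hws, hR7]
    -- The tightest use of η > 50: the exponent is (0.02 - 0.63 · 0.14)L = -0.0682L ≤ -3 log n. The
    -- inequality here needs n a little above 300.
    have h2 : 0.14 * L ≤ (p : ℝ) * (n / 7 - 1) := by
      rw [← hL]
      nlinarith
    push_cast
    linarith
  have hP : ∀ y : Fin n, (SimpleGraph.binomialRandom (Fin n) p).real {G | ¬ (nbrSum G ν y ≤
      0.4 * L * R / n ∧ (R = 7 → 0.14 * L / n ≤ nbrSum G ν y))} ≤ 2 / (n : ℝ) ^ 3 := by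
    intro y
    have h2 : (2 : ℝ) / (n : ℝ) ^ 3 = 1 / (n : ℝ) ^ 3 + 1 / (n : ℝ) ^ 3 := by ring
    rw [h2]
    by_cases hR7 : R = 7
    · refine (measureReal_mono fun G hG => ?_).trans (measureReal_or_le _ (hup y) (hlow hR7 y))
      by_contra hcon
      simp only [Set.mem_ofPred_eq, not_or, not_le] at hcon
      exact hG ⟨hcon.1.le, fun _ => hcon.2.le⟩
    · refine (measureReal_mono fun G hG => ?_).trans
        ((hup y).trans (le_add_of_nonneg_right (by positivity)))
      by_contra hcon
      simp only [Set.mem_ofPred_eq, not_le] at hcon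
      exact hG ⟨hcon.le, fun h => absurd h hR7⟩
  refine (measureReal_mono fun G hG => ?_).trans
    ((measureReal_exists_le _ hP).trans ?_)
  · simpa [GoodStep] using hG
  · simp only [Finset.sum_const, Finset.card_univ, Fintype.card_fin, nsmul_eq_mul]
    apply le_of_eq
    field_simp

end GraphEvents

/-! ### Products of stochastic matrices -/

section Transition

variable {V : Type*} [Fintype V] [DecidableEq V] (P : ℤ → Matrix V V ℝ)

lemma transitionProd_self (s : ℤ) : transitionProd P s s = 1 := by
  simp [transitionProd]

lemma transitionProd_succ_right {s t : ℤ} (h : s ≤ t) :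
    transitionProd P s (t + 1) = transitionProd P s t * P (t + 1) := by
  have h1 : (t + 1 - s).toNat = (t - s).toNat + 1 := by omega
  have h2 : s + 1 + ((t - s).toNat : ℤ) = t + 1 := by omega
  rw [transitionProd, h1, List.range_succ, List.map_append, List.prod_append, List.map_singleton,
    List.prod_singleton, h2, transitionProd]

lemma transitionProd_pred_left {s t : ℤ} (h : s ≤ t) :
    transitionProd P (s - 1) t = P s * transitionProd P s t := by
  have h1 : (t - (s - 1)).toNat = (t - s).toNat + 1 := by omega
  rw [transitionProd, h1, List.range_succ_eq_map]
  simp only [List.map_cons, List.map_map, List.prod_cons, transitionProd]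
  congr 1
  · simp
  · congr 2
    funext k
    simp only [Function.comp_apply]
    congr 1
    push_cast
    ring

lemma transitionProd_congr {P P' : ℤ → Matrix V V ℝ} {s t : ℤ}
    (h : ∀ u ∈ Finset.Ioc s t, P u = P' u) : transitionProd P s t = transitionProd P' s t := by
  rw [transitionProd, transitionProd]
  congr 1
  refine List.map_congr_left fun k hk => h _ ?_
  rw [List.mem_range] at hk
  rw [Finset.mem_Ioc]
  omega

variable {P}

lemma transitionProd_induction {C : Matrix V V ℝ → Prop} (h1 : C 1)
    (hmul : ∀ A u, C A → C (A * P u)) (s t : ℤ) : C (transitionProd P s t) := by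
  rcases le_total s t with h | h
  · induction t, h using Int.leInduction with
    | base => rwa [transitionProd_self]
    | succ t hst ih => rw [transitionProd_succ_right P hst]; exact hmul _ _ ih
  · have h2 : (t - s).toNat = 0 := by omega
    simpa [transitionProd, h2] using h1

lemma transitionProd_nonneg (h0 : ∀ u x y, 0 ≤ P u x y) (s t : ℤ) (x y : V) :
    0 ≤ transitionProd P s t x y := by
  refine transitionProd_induction (C := fun A : Matrix V V ℝ => ∀ x y, 0 ≤ A x y) ?_ ?_ s t x y
  · intro x y
    rw [Matrix.one_apply]
    split_ifs <;> norm_num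
  · intro A u hA x y
    exact Finset.sum_nonneg fun z _ => mul_nonneg (hA x z) (h0 u z y)

lemma transitionProd_sum (h1 : ∀ u x, ∑ y, P u x y = 1) (s t : ℤ) (x : V) :
    ∑ y, transitionProd P s t x y = 1 := by
  refine transitionProd_induction (C := fun A : Matrix V V ℝ => ∀ x, ∑ y, A x y = 1) ?_ ?_ s t x
  · intro x
    simp [Matrix.one_apply]
  · intro A u hA x
    simp_rw [Matrix.mul_apply]
    rw [Finset.sum_comm]
    simp_rw [← Finset.mul_sum, h1, mul_one, hA]

end Transition

/-! ### The lazy walk matrix -/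

section LazyWalk

open scoped Classical

variable {V : Type*} [Fintype V] (G : SimpleGraph V)

lemma nbrSum_one_eq_degree (x : V) : nbrSum G (fun _ => 1) x = G.degree x := by
  rw [nbrSum, Finset.sum_boole, ← SimpleGraph.card_neighborFinset_eq_degree]
  congr 2
  ext y
  simp

lemma lazyWalk_nonneg (x y : V) : 0 ≤ lazyWalk G x y := by
  simp only [lazyWalk, Matrix.of_apply]
  split_ifs <;> positivity

lemma lazyWalk_eq_add (x y : V) : lazyWalk G x y =
    (if x = y then (if 1 ≤ G.degree x then 1 / 2 else 1) else 0) +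
      if G.Adj x y then 1 / (2 * (G.degree x : ℝ)) else 0 := by
  simp only [lazyWalk, Matrix.of_apply]
  by_cases h : x = y
  · subst h
    simp
  · simp [h]

lemma lazyWalk_sum (x : V) : ∑ y, lazyWalk G x y = 1 := by
  simp_rw [lazyWalk_eq_add, Finset.sum_add_distrib]
  have h : (∑ y, if G.Adj x y then 1 / (2 * (G.degree x : ℝ)) else 0) =
      1 / (2 * (G.degree x : ℝ)) * G.degree x := by
    generalize 1 / (2 * (G.degree x : ℝ)) = c
    rw [← nbrSum_one_eq_degree, ← nbrSum_smul, nbrSum]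
    simp
  rw [h]
  by_cases hd : 1 ≤ G.degree x
  · have : (G.degree x : ℝ) ≠ 0 := by
      have : G.degree x ≠ 0 := by omega
      exact_mod_cast this
    simp only [Finset.sum_ite_eq, Finset.mem_univ, if_true, if_pos hd]
    field_simp
    norm_num
  · have : G.degree x = 0 := by omega
    simp [this]

lemma le_lazyWalk_of_complete (hG : ∀ x y, x ≠ y → G.Adj x y) (x y : V) :
    1 / (2 * (Fintype.card V : ℝ)) ≤ lazyWalk G x y := by
  have hV : (1 : ℝ) ≤ Fintype.card V := by exact_mod_cast Fintype.card_pos_iff.2 ⟨x⟩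
  rw [lazyWalk_eq_add]
  by_cases hxy : x = y
  · subst hxy
    have h1 : 1 / (2 * (Fintype.card V : ℝ)) ≤ 1 / 2 :=
      one_div_le_one_div_of_le (by norm_num) (by linarith)
    simp only [if_true, SimpleGraph.irrefl, if_false, add_zero]
    split_ifs
    · exact h1
    · exact h1.trans (by norm_num)
  · have h1 : (0 : ℝ) < G.degree x := by
      exact_mod_cast (G.degree_pos_iff_exists_adj x).2 ⟨y, hG x y hxy⟩
    have h2 : (G.degree x : ℝ) ≤ Fintype.card V := by exact_mod_cast (G.degree_lt_card_verts x).le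
    rw [if_neg hxy, if_pos (hG x y hxy), zero_add]
    exact one_div_le_one_div_of_le (by linarith) (by linarith)

lemma vecMul_lazyWalk (ν : V → ℝ) (y : V) (hy : 1 ≤ G.degree y) :
    ∑ x, ν x * lazyWalk G x y =
      ν y / 2 + nbrSum G (fun x => ν x / (2 * (G.degree x : ℝ))) y := by
  simp_rw [lazyWalk_eq_add, mul_add, Finset.sum_add_distrib]
  congr 1
  · simp [hy, div_eq_mul_inv]
  · rw [nbrSum]
    refine Finset.sum_congr rfl fun x _ => ?_
    simp only [G.adj_comm x y]
    split_ifs <;> ring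

lemma nbrSum_mono {f g : V → ℝ} (h : ∀ x, f x ≤ g x) (y : V) : nbrSum G f y ≤ nbrSum G g y := by
  refine Finset.sum_le_sum fun x _ => ?_
  split_ifs
  · exact h x
  · exact le_rfl

end LazyWalk

/-! ### One step of the walk on a good graph -/

section GoodGraphs

open scoped Classical

variable {n : ℕ} {L R : ℝ} {ν : Fin n → ℝ} {G : SimpleGraph (Fin n)}

lemma GoodGraph.degree_mem (hG : GoodGraph n L G) (x : Fin n) :
    L / 2 ≤ (G.degree x : ℝ) ∧ (G.degree x : ℝ) ≤ 2 * L := by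
  simpa only [nbrSum_one_eq_degree] using hG.1 x

lemma GoodGraph.one_le_degree (hL : 0 < L) (hG : GoodGraph n L G) (x : Fin n) :
    1 ≤ G.degree x := by
  have h1 : (0 : ℝ) < G.degree x := lt_of_lt_of_le (by linarith) (hG.degree_mem x).1
  exact_mod_cast h1

/-- The lazy part contributes at most R/(2n). Degrees at least L/2 turn the neighbour sum into at
most 0.4R/n. -/
lemma step_upper (hL : 0 < L) (hG : GoodGraph n L G) (hS : GoodStep n L R ν G)
    (h0 : ∀ x, 0 ≤ ν x) (h1 : ∀ x, ν x ≤ R / n) (y : Fin n) :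
    ∑ x, ν x * lazyWalk G x y ≤ 0.9 * R / n := by
  rw [vecMul_lazyWalk G ν y (hG.one_le_degree hL y)]
  have h2 : nbrSum G (fun x => ν x / (2 * (G.degree x : ℝ))) y ≤
      nbrSum G (fun x => 1 / L * ν x) y := by
    refine nbrSum_mono G (fun x => ?_) y
    rw [one_div, ← div_eq_inv_mul]
    exact div_le_div_of_nonneg_left (h0 x) hL (by linarith [(hG.degree_mem x).1])
  rw [nbrSum_smul] at h2
  have h3 : 1 / L * nbrSum G ν y ≤ 1 / L * (0.4 * L * R / n) :=
    mul_le_mul_of_nonneg_left (hS y).1 (by positivity)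
  have h4 : 1 / L * (0.4 * L * R / n) = 0.4 * (R / n) := by field_simp
  have h5 : 0.9 * R / n = 0.9 * (R / n) := by ring
  rw [h5]
  linarith [h1 y]

/-- Only the mass arriving from neighbours is kept. Degrees at most 2L give 0.14/4 = 0.035. -/
lemma step_lower (hL : 0 < L) (hG : GoodGraph n L G) (hS : GoodStep n L 7 ν G)
    (h0 : ∀ x, 0 ≤ ν x) (y : Fin n) :
    0.035 / n ≤ ∑ x, ν x * lazyWalk G x y := by
  rw [vecMul_lazyWalk G ν y (hG.one_le_degree hL y)]
  have h2 : nbrSum G (fun x => 1 / (4 * L) * ν x) y ≤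
      nbrSum G (fun x => ν x / (2 * (G.degree x : ℝ))) y := by
    refine nbrSum_mono G (fun x => ?_) y
    rw [one_div, ← div_eq_inv_mul]
    have h3 := hG.degree_mem x
    exact div_le_div_of_nonneg_left (h0 x) (by linarith) (by linarith)
  rw [nbrSum_smul] at h2
  have h3 : 1 / (4 * L) * (0.14 * L / n) ≤ 1 / (4 * L) * nbrSum G ν y :=
    mul_le_mul_of_nonneg_left ((hS y).2 rfl) (by positivity)
  have h4 : 1 / (4 * L) * (0.14 * L / n) = 0.035 / n := by
    field_simp
    norm_num
  linarith [h0 y]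

end GoodGraphs

/-! ### Existence of the target by contraction of oscillation -/

section Contraction

variable {V : Type*} [Fintype V]

lemma sum_mul_le_of_stochastic {q f : V → ℝ} {M m ε : ℝ} (hq : ∀ x, 0 ≤ q x)
    (hsum : ∑ x, q x = 1) (hM : ∀ x, f x ≤ M) (z : V) (hz : f z = m) (hε : ε ≤ q z) :
    ∑ x, q x * f x ≤ M - ε * (M - m) := by
  classical
  have h1 : ∑ x, q x * f x = M - ∑ x, q x * (M - f x) := by
    simp_rw [mul_sub, Finset.sum_sub_distrib, ← Finset.sum_mul, hsum]
    ring
  have h2 : q z * (M - f z) ≤ ∑ x, q x * (M - f x) :=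
    Finset.single_le_sum (f := fun x => q x * (M - f x))
      (fun x _ => mul_nonneg (hq x) (sub_nonneg.2 (hM x))) (Finset.mem_univ z)
  have h3 : ε * (M - f z) ≤ q z * (M - f z) :=
    mul_le_mul_of_nonneg_right hε (sub_nonneg.2 (hM z))
  rw [h1, ← hz]
  linarith

/-- Averaging a function successively by stochastic matrices, infinitely many of which are
uniformly positive, makes it converge to a constant. -/
lemma exists_tendsto_of_frequently_positive [Nonempty V] {Q : ℕ → Matrix V V ℝ} {f : ℕ → V → ℝ}
    (hQ0 : ∀ k x y, 0 ≤ Q k x y) (hQ1 : ∀ k x, ∑ y, Q k x y = 1)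
    (hf : ∀ k x, f (k + 1) x = ∑ y, Q k x y * f k y) {ε : ℝ} (hε : 0 < ε)
    (hfreq : ∃ᶠ k in atTop, ∀ x y, ε ≤ Q k x y) :
    ∃ c, ∀ x, Tendsto (fun k => f k x) atTop (𝓝 c) := by
  choose a ha using fun k => Finite.exists_max (f k)
  choose b hb using fun k => Finite.exists_min (f k)
  -- With δ = 0 this gives monotonicity of the maximum, with δ = ε the contraction.
  have hup : ∀ k (δ : ℝ), (∀ x y, δ ≤ Q k x y) →
      f (k + 1) (a (k + 1)) ≤ f k (a k) - δ * (f k (a k) - f k (b k)) := by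
    intro k δ hδ
    rw [hf]
    exact sum_mul_le_of_stochastic (hQ0 k _) (hQ1 k _) (ha k) (b k) rfl (hδ _ _)
  have hlow : ∀ k, f k (b k) ≤ f (k + 1) (b (k + 1)) := by
    intro k
    have h := sum_mul_le_of_stochastic (f := fun x => -f k x) (M := -f k (b k)) (hQ0 k (b (k + 1)))
      (hQ1 k _) (fun x => neg_le_neg (hb k x)) (b k) rfl (hQ0 _ _ _)
    rw [hf]
    simp only [mul_neg, Finset.sum_neg_distrib] at h
    linarith
  have hanti : Antitone fun k => f k (a k) :=
    antitone_nat_of_succ_le fun k => by simpa using hup k 0 (hQ0 k)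
  have hmono : Monotone fun k => f k (b k) := monotone_nat_of_le_succ hlow
  obtain ⟨M, hM⟩ : ∃ M, Tendsto (fun k => f k (a k)) atTop (𝓝 M) :=
    ⟨_, tendsto_atTop_ciInf hanti ⟨f 0 (b 0), by
      rintro _ ⟨k, rfl⟩
      exact (hmono (Nat.zero_le k)).trans (ha k _)⟩⟩
  obtain ⟨m, hm⟩ : ∃ m, Tendsto (fun k => f k (b k)) atTop (𝓝 m) :=
    ⟨_, tendsto_atTop_ciSup hmono ⟨f 0 (a 0), by
      rintro _ ⟨k, rfl⟩
      exact (hb k _).trans (hanti (Nat.zero_le k))⟩⟩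
  have hmM : m ≤ M := le_of_tendsto_of_tendsto' hm hM fun k => hb k _
  -- The extrema converge by monotonicity, so the contraction inequality passes to the limit
  -- although it holds only for infinitely many k.
  have hMm : M ≤ M - ε * (M - m) := by
    have h1 : Tendsto (fun k => f k (a k) - ε * (f k (a k) - f k (b k))) atTop
        (𝓝 (M - ε * (M - m))) := hM.sub ((hM.sub hm).const_mul ε)
    exact le_of_tendsto_of_tendsto_of_frequently ((tendsto_add_atTop_iff_nat 1).2 hM) h1
      (hfreq.mono fun k hk => hup k ε hk)
  have hEq : M = m := le_antisymm (by nlinarith) hmM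
  subst hEq
  exact ⟨M, fun x => tendsto_of_tendsto_of_tendsto_of_le_of_le hm hM
    (fun k => hb k x) fun k => ha k x⟩

/-- Since P^{s-1,t} = P_s P^{s,t}, moving the start one step back averages each column of P^{s,t} by
a stochastic matrix. The limit of a column is constant, hence independent of the starting state. -/
lemma targetExists_of_frequently_positive [DecidableEq V] [Nonempty V] {P : ℤ → Matrix V V ℝ}
    (h0 : ∀ u x y, 0 ≤ P u x y) (h1 : ∀ u x, ∑ y, P u x y = 1) {ε : ℝ} (hε : 0 < ε)
    (hfreq : ∃ᶠ u in atBot, ∀ x y, ε ≤ P u x y) (t : ℤ) : TargetExists P t := by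
  have hfreq' : ∃ᶠ k : ℕ in atTop, ∀ x y, ε ≤ P (t - k) x y := by
    rw [frequently_atTop]
    intro N
    obtain ⟨u, hu, hP⟩ := frequently_atBot.1 hfreq (t - N)
    refine ⟨(t - u).toNat, by omega, ?_⟩
    have : t - ((t - u).toNat : ℤ) = u := by omega
    rwa [this]
  have hcol : ∀ y, ∃ c, ∀ x,
      Tendsto (fun k : ℕ => transitionProd P (t - k) t x y) atTop (𝓝 c) := by
    intro y
    refine exists_tendsto_of_frequently_positive (Q := fun k => P (t - k))
      (f := fun k x => transitionProd P (t - k) t x y) (fun k => h0 _) (fun k => h1 _) ?_ hε hfreq'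
    intro k x
    have : t - ((k + 1 : ℕ) : ℤ) = t - k - 1 := by push_cast; ring
    rw [this, transitionProd_pred_left P (by omega), Matrix.mul_apply]
  choose c hc using hcol
  refine ⟨c, fun x y => ?_⟩
  have h2 : Tendsto (fun s : ℤ => (t - s).toNat) atBot atTop := by
    rw [tendsto_atTop]
    intro N
    filter_upwards [eventually_le_atBot (t - N)] with s hs
    omega
  refine ((hc y x).comp h2).congr' ?_
  filter_upwards [eventually_le_atBot t] with s hs
  have : t - ((t - s).toNat : ℤ) = s := by omega
  simp only [Function.comp_apply, this]

lemma isTarget_target [DecidableEq V] {P : ℤ → Matrix V V ℝ} {t : ℤ} (h : TargetExists P t) :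
    IsTarget P t (target P t) := by
  rw [target, dif_pos h]
  exact h.choose_spec

end Contraction

/-! ### Bounds inherited by the target -/

section Target

variable {V : Type*} [Fintype V] [DecidableEq V] {P : ℤ → Matrix V V ℝ} {t : ℤ}

lemma target_sum [Nonempty V] (h : TargetExists P t) (h1 : ∀ u x, ∑ y, P u x y = 1) :
    ∑ y, target P t y = 1 := by
  obtain ⟨x⟩ := ‹Nonempty V›
  have h2 := tendsto_finsetSum Finset.univ fun y _ => isTarget_target h x y
  simp_rw [transitionProd_sum h1] at h2
  exact tendsto_nhds_unique h2 tendsto_const_nhds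

/-- As convergence is already known, bounds at arbitrarily early starting times suffice. Controlling
the walk from all early times at once is not needed. -/
lemma target_mem_Icc_of_frequently (h : TargetExists P t) (x : V) {a b : ℝ}
    (hf : ∃ᶠ s in atBot, ∀ y, transitionProd P s t x y ∈ Set.Icc a b) (y : V) :
    target P t y ∈ Set.Icc a b :=
  isClosed_Icc.mem_of_frequently_of_tendsto (hf.mono fun _ hs => hs y) (isTarget_target h x y)

end Target

/-! ### From mass bounds and expansion to Θ -/

section Bottleneck

open scoped Classical

lemma cutSize_compl {V : Type*} [Fintype V] [DecidableEq V] (G : SimpleGraph V) (S : Finset V) :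
    cutSize G Sᶜ = cutSize G S := by
  rw [cutSize, cutSize, compl_compl, Finset.sum_comm]
  simp_rw [G.adj_comm]

variable {n : ℕ} {L : ℝ} {G : ℤ → SimpleGraph (Fin n)} {s : ℤ}

lemma mul_cutSize_le_flow (hL : 0 < L) (hG : GoodGraph n L (G s)) {c : ℝ} (hc : 0 ≤ c)
    (hπ : ∀ x, c ≤ target (fun s => lazyWalk (G s)) (s - 1) x) (S : Finset (Fin n)) :
    c / (4 * L) * cutSize (G s) S ≤ flow (fun s => lazyWalk (G s)) s S Sᶜ := by
  rw [flow, Finset.sum_comm, cutSize, Finset.mul_sum]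
  refine Finset.sum_le_sum fun x _ => ?_
  rw [Finset.mul_sum]
  refine Finset.sum_le_sum fun y _ => ?_
  have h1 : (1 / (4 * L)) * (if (G s).Adj x y then 1 else 0) ≤ lazyWalk (G s) x y := by
    split_ifs with h
    · have h2 := hG.degree_mem x
      rw [lazyWalk_eq_add, if_neg h.ne, if_pos h, zero_add, mul_one]
      exact one_div_le_one_div_of_le (by linarith) (by linarith)
    · simpa using lazyWalk_nonneg (G s) x y
  have h3 : (0 : ℝ) ≤ (1 / (4 * L)) * (if (G s).Adj x y then 1 else 0) := by
    split_ifs <;> positivity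
  calc c / (4 * L) * (if (G s).Adj x y then 1 else 0)
      = c * ((1 / (4 * L)) * (if (G s).Adj x y then 1 else 0)) := by ring
    _ ≤ _ := mul_le_mul (hπ x) h1 h3 (hc.trans (hπ x))

lemma targetMass_add_compl {V : Type*} [Fintype V] [DecidableEq V] {P : ℤ → Matrix V V ℝ} {t : ℤ}
    (h : ∑ y, target P t y = 1) (S : Finset V) :
    targetMass P t S + targetMass P t Sᶜ = 1 := by
  rw [← h]
  exact Finset.sum_add_sum_compl S _

lemma targetMass_le_card {V : Type*} [Fintype V] [DecidableEq V] {P : ℤ → Matrix V V ℝ} {t : ℤ}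
    {b : ℝ} (h : ∀ x, target P t x ≤ b) (S : Finset V) : targetMass P t S ≤ S.card * b := by
  rw [← nsmul_eq_mul]
  exact Finset.sum_le_card_nsmul S _ b fun x _ => h x

/-- If |S| ≤ n/2, expansion applies to S, with π(S) ≤ 7|S|/n. Otherwise it applies to Sᶜ, which has
the same cut and π(S) ≤ 1/2 ≤ π(Sᶜ) ≤ 7|Sᶜ|/n. Here 70 = 7 · 10. -/
lemma targetMass_mul_le_cutSize (hn : 0 < n) (hL : 0 < L) (hG : GoodGraph n L (G s))
    (hπ : ∀ x, target (fun s => lazyWalk (G s)) (s - 1) x ≤ 7 / n)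
    (hsum : ∑ x, target (fun s => lazyWalk (G s)) (s - 1) x = 1)
    {S : Finset (Fin n)} (hS : S.Nonempty)
    (hS2 : targetMass (fun s => lazyWalk (G s)) (s - 1) S ≤ 1 / 2) :
    L * n / 70 * targetMass (fun s => lazyWalk (G s)) (s - 1) S ≤ cutSize (G s) S := by
  have hn' : (0 : ℝ) < n := by exact_mod_cast hn
  have key : ∀ T : Finset (Fin n), targetMass (fun s => lazyWalk (G s)) (s - 1) S ≤
      T.card * (7 / n) → L * T.card / 10 ≤ cutSize (G s) T →
      L * n / 70 * targetMass (fun s => lazyWalk (G s)) (s - 1) S ≤ cutSize (G s) T := by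
    intro T h1 h2
    refine le_trans ?_ h2
    calc L * n / 70 * targetMass (fun s => lazyWalk (G s)) (s - 1) S
        ≤ L * n / 70 * (T.card * (7 / n)) := mul_le_mul_of_nonneg_left h1 (by positivity)
      _ = L * T.card / 10 := by field_simp; ring
  by_cases hc : 2 * S.card ≤ n
  · exact key S (targetMass_le_card hπ S) (hG.2 S hS hc)
  · rw [← cutSize_compl]
    have h1 := targetMass_add_compl hsum S
    have h2 := targetMass_le_card hπ Sᶜ
    have h3 : Sᶜ.card = n - S.card := by rw [Finset.card_compl, Fintype.card_fin]
    refine key Sᶜ (by linarith) (hG.2 Sᶜ ?_ (by omega))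
    rw [Finset.nonempty_iff_ne_empty]
    intro h4
    rw [h4] at h1
    simp only [targetMass, Finset.sum_empty] at h1 hS2
    linarith

lemma le_bottleneckRatio (hn : 14 ≤ n) (hL : 0 < L) (hG : GoodGraph n L (G s))
    (hπ : ∀ x, target (fun s => lazyWalk (G s)) (s - 1) x ∈ Set.Icc (0.035 / (n : ℝ)) (7 / n))
    (hsum : ∑ x, target (fun s => lazyWalk (G s)) (s - 1) x = 1) :
    0.000125 ≤ bottleneckRatio (fun s => lazyWalk (G s)) s := by
  have hn0 : 0 < n := by omega
  have hn' : (14 : ℝ) ≤ n := by exact_mod_cast hn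
  have hc : (0 : ℝ) < 0.035 / n := by positivity
  refine le_csInf ?_ ?_
  -- The infimum must run over a nonempty set, as `sInf ∅ = 0`. A singleton has mass at most 7/n ≤
  -- 1/2.
  · refine ⟨_, {⟨0, hn0⟩}, Finset.singleton_nonempty _, ?_, rfl⟩
    rw [targetMass, Finset.sum_singleton]
    refine (hπ _).2.trans ?_
    rw [div_le_div_iff₀ (by linarith) (by norm_num)]
    linarith
  · rintro r ⟨S, hS, hS2, rfl⟩
    have hpos : 0 < targetMass (fun s => lazyWalk (G s)) (s - 1) S :=
      Finset.sum_pos (fun x _ => hc.trans_le (hπ x).1) hS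
    have h1 := mul_cutSize_le_flow hL hG hc.le (fun x => (hπ x).1) S
    have h2 := mul_cutSize_le_flow hL hG hc.le (fun x => (hπ x).1) Sᶜ
    rw [compl_compl, cutSize_compl] at h2
    have h3 := targetMass_mul_le_cutSize hn0 hL hG (fun x => (hπ x).2) hsum hS hS2
    have h4 := mul_le_mul_of_nonneg_left h3 (show 0 ≤ 0.035 / (n : ℝ) / (4 * L) by positivity)
    have h5 : 0.035 / (n : ℝ) / (4 * L) *
        (L * n / 70 * targetMass (fun s => lazyWalk (G s)) (s - 1) S) =
        0.000125 * targetMass (fun s => lazyWalk (G s)) (s - 1) S := by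
      field_simp
      norm_num
    rw [bottleneck, one_div, ← div_eq_inv_mul, le_div_iff₀ (by linarith)]
    linarith

/-- The upper bound holds because two distributions of equal total mass cannot satisfy π_{s-1} > π_s
everywhere. -/
lemma changeRate_mem_Icc {V : Type*} [Fintype V] [DecidableEq V] [Nonempty V]
    {P : ℤ → Matrix V V ℝ} {s : ℤ} {a b : ℝ} (ha : 0 < a)
    (h1 : ∀ x, target P (s - 1) x ∈ Set.Icc a b) (h2 : ∀ x, target P s x ∈ Set.Icc a b)
    (hs1 : ∑ x, target P (s - 1) x = 1) (hs2 : ∑ x, target P s x = 1) :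
    changeRate P s ∈ Set.Icc (a / b) 1 := by
  constructor
  · exact le_ciInf fun z => div_le_div₀ (ha.le.trans (h1 z).1) (h1 z).1 (ha.trans_le (h2 z).1)
      (h2 z).2
  · obtain ⟨z, -, hz⟩ := Finset.exists_le_of_sum_le (s := Finset.univ) Finset.univ_nonempty
      (hs1.trans hs2.symm).le
    exact (ciInf_le (Set.finite_range _).bddBelow z).trans
      (div_le_one_of_le₀ hz (ha.le.trans (h2 z).1))

lemma le_Theta (hn : 14 ≤ n) (hL : 0 < L)
    (hex : ∀ t, TargetExists (fun s => lazyWalk (G s)) t)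
    (hG : ∀ s ∈ Set.Icc (1 : ℤ) n, GoodGraph n L (G s))
    (hπ : ∀ t ∈ Set.Icc (0 : ℤ) n, ∀ x,
      target (fun s => lazyWalk (G s)) t x ∈ Set.Icc (0.035 / (n : ℝ)) (7 / n))
    {c : ℝ} (hc0 : 0 ≤ c) (hc : c ≤ 0.0000003) {t : ℤ} (ht : t ∈ Set.Icc (0 : ℤ) n) :
    ((c ^ 2 : ℝ) : EReal) ≤ Theta (fun s => lazyWalk (G s)) t := by
  have : Nonempty (Fin n) := ⟨⟨0, by omega⟩⟩
  have hn' : (0 : ℝ) < n := by exact_mod_cast (show 0 < n by omega)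
  refine le_iInf₂ fun s hs => ?_
  rw [EReal.coe_le_coe_iff]
  have hsn : s ∈ Set.Icc (1 : ℤ) n := ⟨hs.1, hs.2.trans ht.2⟩
  have hs0 : s ∈ Set.Icc (0 : ℤ) n := ⟨by have := hsn.1; omega, hsn.2⟩
  have hs1 : s - 1 ∈ Set.Icc (0 : ℤ) n :=
    ⟨by have := hsn.1; omega, by have := hsn.2; omega⟩
  have hsum : ∀ t, ∑ x, target (fun s => lazyWalk (G s)) t x = 1 :=
    fun t => target_sum (hex t) fun u x => lazyWalk_sum (G u) x
  have hΦ := le_bottleneckRatio hn hL (hG s hsn) (hπ _ hs1) (hsum _)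
  obtain ⟨hg1, hg2⟩ := changeRate_mem_Icc (by positivity) (hπ _ hs1) (hπ _ hs0) (hsum _) (hsum _)
  have h5 : 0.035 / (n : ℝ) / (7 / n) = 0.005 := by
    field_simp
    norm_num
  rw [h5] at hg1
  set g := changeRate (fun s => lazyWalk (G s)) s
  -- The bound g ≤ 1 keeps the denominator positive.
  have h6 : 0.005 ≤ g / (1 - 1 / 2 * g) := by
    rw [le_div_iff₀ (by linarith)]
    linarith
  refine pow_le_pow_left₀ hc0 (hc.trans ?_) 2
  calc (0.0000003 : ℝ) ≤ 1 / 2 * 0.005 * 0.000125 := by norm_num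
    _ ≤ _ := mul_le_mul (mul_le_mul_of_nonneg_left h6 (by norm_num)) hΦ (by norm_num)
        (by linarith)

end Bottleneck

/-! ### Independence of the graphs at different times -/

section Product

open ProbabilityTheory

variable {X : Type*} [MeasurableSpace X] [MeasurableSingletonClass X]
  (ν : Measure X) [IsProbabilityMeasure ν]

/-- If the coordinate `t` is independent of the coordinates in `F`, and `D` depends on those only,
then the probability that `ω t ∈ D ω` is at most the largest probability of the sets `D ω`. -/
lemma infinitePi_real_mem_le [Finite X] {ι : Type*} {F : Finset ι} {t : ι} (ht : t ∉ F)
    {D : (ι → X) → Set X} (hD : ∀ ω ω', (∀ u ∈ F, ω u = ω' u) → D ω = D ω') {c : ℝ}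
    (hc : ∀ ω, ν.real (D ω) ≤ c) :
    (Measure.infinitePi fun _ : ι => ν).real {ω | ω t ∈ D ω} ≤ c := by
  classical
  obtain ⟨x₀⟩ : Nonempty X := nonempty_of_isProbabilityMeasure ν
  have hc0 : 0 ≤ c := measureReal_nonneg.trans (hc fun _ => x₀)
  -- Coordinates outside `F` are frozen at `x₀`. The event then lives on the finite space (F → X) ×
  -- X, where it is measurable and Fubini applies.
  let ext : (F → X) → ι → X := fun h i => if hi : i ∈ F then h ⟨i, hi⟩ else x₀
  let r : (ι → X) → F → X := fun ω i => ω i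
  have hext : ∀ ω, D ω = D (ext (r ω)) := fun ω => hD _ _ fun u hu => by simp [ext, r, hu]
  have hr : Measurable r := by fun_prop
  have het : Measurable fun ω : ι → X => ω t := measurable_pi_apply t
  have hind : IndepFun r (fun ω => ω t) (Measure.infinitePi fun _ : ι => ν) := by
    have h1 : iIndepFun (fun (i : ι) (ω : ι → X) => ω i) (Measure.infinitePi fun _ : ι => ν) :=
      iIndepFun_infinitePi (X := fun _ x => x) fun _ => measurable_id
    exact (h1.indepFun_finset F {t} (by simpa using ht) fun i => measurable_pi_apply i).comp
      measurable_id (measurable_pi_apply (⟨t, Finset.mem_singleton_self t⟩ : ({t} : Finset ι)))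
  have hset : {ω : ι → X | ω t ∈ D ω} =
      (fun ω => (r ω, ω t)) ⁻¹' {q : (F → X) × X | q.2 ∈ D (ext q.1)} := by
    ext ω
    simp only [Set.mem_ofPred_eq, Set.mem_preimage]
    rw [← hext]
  have hmeas : MeasurableSet {q : (F → X) × X | q.2 ∈ D (ext q.1)} := Set.toFinite _ |>.measurableSet
  refine ENNReal.toReal_le_of_le_ofReal hc0 ?_
  rw [hset, ← Measure.map_apply (hr.prodMk het) hmeas,
    (indepFun_iff_map_prod_eq_prod_map_map hr.aemeasurable het.aemeasurable).1 hind,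
    Measure.infinitePi_map_eval]
  have : IsProbabilityMeasure (Measure.map r (Measure.infinitePi fun _ : ι => ν)) :=
    Measure.isProbabilityMeasure_map hr.aemeasurable
  rw [Measure.prod_apply hmeas]
  calc _ ≤ ∫⁻ _, ENNReal.ofReal c ∂(Measure.map r (Measure.infinitePi fun _ : ι => ν)) := by
        refine lintegral_mono fun h => ?_
        rw [← ENNReal.ofReal_toReal (measure_ne_top ν _)]
        exact ENNReal.ofReal_le_ofReal (hc (ext h))
    _ = ENNReal.ofReal c := by simp

/-- Missing `x` at k given times has probability (1 - ν{x})^k, which tends to 0. Then intersect over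
the countably many N. -/
lemma infinitePi_ae_frequently_eq {x : X} (hx : ν {x} ≠ 0) :
    ∀ᵐ ω ∂(Measure.infinitePi fun _ : ℤ => ν), ∃ᶠ u in atBot, ω u = x := by
  have hq : ν {x}ᶜ < 1 := by
    rw [prob_compl_eq_one_sub (measurableSet_singleton x)]
    exact ENNReal.sub_lt_self ENNReal.one_ne_top one_ne_zero hx
  have h1 : ∀ N : ℤ, ∀ᵐ ω ∂(Measure.infinitePi fun _ : ℤ => ν), ∃ u ≤ N, ω u = x := by
    intro N
    rw [ae_iff]
    refine le_antisymm (ge_of_tendsto' (ENNReal.tendsto_pow_atTop_nhds_zero_of_lt_one hq)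
      fun k => ?_) zero_le
    have h2 := Measure.infinitePi_pi (fun _ : ℤ => ν) (s := Finset.Ioc (N - k) N)
      (t := fun _ => {x}ᶜ) fun _ _ => (measurableSet_singleton x).compl
    have h3 : (Finset.Ioc (N - k) N).card = k := by simp
    rw [Finset.prod_const, h3] at h2
    rw [← h2]
    refine measure_mono fun ω hω u hu => ?_
    simp only [Set.mem_ofPred_eq, not_exists, not_and] at hω
    exact hω u (Finset.mem_Ioc.1 hu).2
  filter_upwards [ae_all_iff.2 h1] with ω hω
  exact frequently_atBot.2 fun N => by
    obtain ⟨u, hu, h⟩ := hω N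
    exact ⟨u, hu, h⟩

end Product

/-! ### The walk over the window [-n, n] -/

section Runs

variable {n : ℕ}

/-- The bound for `n` times the mass of a point, `j` steps after an arbitrary start. -/
noncomputable def massBound (n j : ℕ) : ℝ := max 7 (n * 0.9 ^ j)

/-- In the window `[-n, n]` there is a bad graph, or a step in which the walk started at `x₀` at
time `-k` fails to be spread by the neighbourhoods of the new graph. -/
def BadRun (L : ℝ) (x₀ : Fin n) (k : ℕ) (G : ℤ → SimpleGraph (Fin n)) : Prop :=
  ∃ j : Fin (2 * n), ¬ GoodGraph n L (G (-n + j + 1)) ∨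
    (∀ y, transitionProd (fun s => lazyWalk (G s)) (-k) (-n + j) x₀ y ≤ massBound n j / n) ∧
      ¬ GoodStep n L (massBound n j) (transitionProd (fun s => lazyWalk (G s)) (-k) (-n + j) x₀)
        (G (-n + j + 1))

instance (p : unitInterval) : IsProbabilityMeasure (dynamicER n p) := by
  unfold dynamicER
  infer_instance

/-- The 2n steps cost 4/n² + 2/n² each. The law before a step depends only on earlier graphs, so it
can be treated as fixed when the new graph is drawn. The bound is uniform in `k`. -/
lemma measureReal_badRun {p : unitInterval} {L : ℝ} (hn : 400 ≤ n) (hL : (p : ℝ) * (n - 1) = L)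
    (hlog : 50 * Real.log n ≤ L) (x₀ : Fin n) (k : ℕ) :
    (dynamicER n p).real {G | BadRun L x₀ k G} ≤ 12 / n := by
  have hn' : (400 : ℝ) ≤ n := by exact_mod_cast hn
  refine (measureReal_exists_le _ (c := fun _ => 4 / (n : ℝ) ^ 2 + 2 / (n : ℝ) ^ 2) fun j =>
    measureReal_or_le _ ?_ ?_).trans ?_
  · exact infinitePi_real_mem_le _ (Finset.notMem_empty (-(n : ℤ) + j + 1))
      (D := fun _ => {H | ¬ GoodGraph n L H}) (fun _ _ _ => rfl)
      fun _ => measureReal_not_goodGraph p hn hL hlog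
  · refine infinitePi_real_mem_le _ (F := Finset.Ioc (-(k : ℤ)) (-n + j)) (t := -(n : ℤ) + j + 1)
      (by rw [Finset.mem_Ioc]; omega)
      (D := fun G => {H |
        (∀ y, transitionProd (fun s => lazyWalk (G s)) (-k) (-n + j) x₀ y ≤ massBound n j / n) ∧
        ¬ GoodStep n L (massBound n j)
          (transitionProd (fun s => lazyWalk (G s)) (-k) (-n + j) x₀) H}) ?_ ?_
    · intro G G' h
      have h2 : transitionProd (fun s => lazyWalk (G s)) (-k) (-n + j) =
          transitionProd (fun s => lazyWalk (G' s)) (-k) (-n + j) :=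
        transitionProd_congr fun u hu => by rw [h u hu]
      simp only [h2]
    · intro G
      -- If the past already violates the mass bound, the event is empty. This is why `BadRun`
      -- includes that bound as a condition.
      by_cases hb : ∀ y, transitionProd (fun s => lazyWalk (G s)) (-k) (-n + j) x₀ y ≤
          massBound n j / n
      · simp only [hb, implies_true, true_and]
        exact measureReal_not_goodStep p hn hL hlog (le_max_left _ _)
          (transitionProd_nonneg (fun u => lazyWalk_nonneg (G u)) _ _ x₀) hb
          (transitionProd_sum (fun u => lazyWalk_sum (G u)) _ _ x₀)
      · simp only [hb, false_and, Set.ofPred_false, measureReal_empty]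
        positivity
  · simp only [Finset.sum_const, Finset.card_univ, Fintype.card_fin, nsmul_eq_mul]
    apply le_of_eq
    push_cast
    field_simp
    norm_num

lemma le_massBound_of_not_badRun {L : ℝ} (hL : 0 < L) {x₀ : Fin n} {k : ℕ} (hk : n ≤ k)
    {G : ℤ → SimpleGraph (Fin n)} (hG : ¬ BadRun L x₀ k G) {j : ℕ} (hj : j ≤ 2 * n) (y : Fin n) :
    transitionProd (fun s => lazyWalk (G s)) (-k) (-n + j) x₀ y ≤ massBound n j / n := by
  have hn : (0 : ℝ) < n := by exact_mod_cast x₀.pos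
  have h0 := transitionProd_nonneg fun u => lazyWalk_nonneg (G u)
  induction j generalizing y with
  | zero =>
    -- At time -n nothing is known beyond masses being at most 1.
    have h1 : (1 : ℝ) ≤ massBound n 0 / n := by
      rw [le_div_iff₀ hn, one_mul]
      simp [massBound]
    refine le_trans ?_ h1
    rw [← transitionProd_sum (fun u => lazyWalk_sum (G u)) (-k) (-n + (0 : ℕ)) x₀]
    exact Finset.single_le_sum (fun y _ => h0 _ _ x₀ y) (Finset.mem_univ y)
  | succ j ih =>
    have ih' := ih (by omega)
    simp only [BadRun, not_exists, not_or, not_and, not_not] at hG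
    obtain ⟨h1, h2⟩ := hG ⟨j, by omega⟩
    have h3 : (-n + ((j + 1 : ℕ) : ℤ)) = -n + j + 1 := by push_cast; ring
    rw [h3, transitionProd_succ_right _ (by omega), Matrix.mul_apply]
    refine (step_upper hL h1 (h2 ih') (h0 _ _ x₀) ih' y).trans ?_
    refine div_le_div_of_nonneg_right ?_ hn.le
    rw [massBound, massBound, mul_max_of_nonneg _ _ (by norm_num)]
    exact max_le_max (by norm_num) (le_of_eq (by ring))

lemma transitionProd_mem_Icc_of_not_badRun {L : ℝ} (hL : 0 < L)
    (hgeo : (n : ℝ) * 0.9 ^ (n - 1) ≤ 7) {x₀ : Fin n} {k : ℕ} (hk : n ≤ k)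
    {G : ℤ → SimpleGraph (Fin n)} (hG : ¬ BadRun L x₀ k G) {t : ℤ} (ht : t ∈ Set.Icc (0 : ℤ) n)
    (y : Fin n) :
    transitionProd (fun s => lazyWalk (G s)) (-k) t x₀ y ∈
      Set.Icc (0.035 / (n : ℝ)) (7 / n) := by
  have hn : 0 < n := x₀.pos
  have hR : ∀ j, n - 1 ≤ j → massBound n j = 7 := fun j hj =>
    max_eq_left (le_trans (mul_le_mul_of_nonneg_left
      (pow_le_pow_of_le_one (by norm_num) (by norm_num) hj) (Nat.cast_nonneg n)) hgeo)
  obtain ⟨ht0, htn⟩ := ht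
  -- From t ≥ 0 it follows that j ≥ n - 1, so the mass bound is already 7/n at time t - 1, as the
  -- lower bound at time t requires.
  obtain ⟨j, rfl⟩ : ∃ j : ℕ, t = -n + j + 1 := ⟨(t + n - 1).toNat, by omega⟩
  constructor
  · have h1 : ∀ y, _ ≤ massBound n j / n :=
      le_massBound_of_not_badRun hL hk hG (j := j) (by omega)
    simp only [BadRun, not_exists, not_or, not_and, not_not] at hG
    obtain ⟨h2, h3⟩ := hG ⟨j, by omega⟩
    have h4 := h3 h1
    rw [hR j (by omega)] at h4
    rw [transitionProd_succ_right _ (by omega), Matrix.mul_apply]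
    exact step_lower hL h2 h4
      (transitionProd_nonneg (fun u => lazyWalk_nonneg (G u)) _ _ x₀) y
  · have h1 := le_massBound_of_not_badRun hL hk hG (j := j + 1) (by omega) y
    rw [hR (j + 1) (by omega)] at h1
    have h2 : (-n + ((j + 1 : ℕ) : ℤ)) = -n + j + 1 := by push_cast; ring
    rwa [h2] at h1

/-- For `n` large the target distributions exist and `Theta` is bounded below, outside an event of
probability at most `12 / n`. -/
lemma le_dynamicER_Theta {p : unitInterval} {L : ℝ} (hn : 400 ≤ n)
    (hL : (p : ℝ) * (n - 1) = L) (hlog : 50 * Real.log n ≤ L) (hp : (p : ℝ) < 1)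
    (hgeo : (n : ℝ) * 0.9 ^ (n - 1) ≤ 7) {c : ℝ} (hc0 : 0 ≤ c) (hc : c ≤ 0.0000003) :
    1 - ENNReal.ofReal (12 / n) ≤ dynamicER n p
      {G | (∀ t : ℤ, TargetExists (fun s => lazyWalk (G s)) t) ∧ ∀ t ∈ Set.Icc (0 : ℤ) n,
        ((c ^ 2 : ℝ) : EReal) ≤ Theta (fun s => lazyWalk (G s)) t} := by
  have hn' : (400 : ℝ) ≤ n := by exact_mod_cast hn
  have hlog0 : 0 < Real.log n := Real.log_pos (by linarith)
  have hL0 : 0 < L := by linarith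
  have hp0 : (0 : ℝ) < p := by
    by_contra h
    have : (p : ℝ) * (n - 1) ≤ 0 := mul_nonpos_of_nonpos_of_nonneg (not_lt.1 h) (by linarith)
    linarith
  have : Nonempty (Fin n) := ⟨⟨0, by omega⟩⟩
  let x₀ : Fin n := ⟨0, by omega⟩
  have htop : SimpleGraph.binomialRandom (Fin n) p {⊤} ≠ 0 := by
    rw [SimpleGraph.binomialRandom_singleton]
    refine mul_ne_zero (pow_ne_zero _ ?_) (pow_ne_zero _ ?_)
    · rw [ENNReal.coe_ne_zero, ← NNReal.coe_ne_zero]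
      exact hp0.ne'
    · rw [ENNReal.coe_ne_zero, ← NNReal.coe_ne_zero]
      exact (sub_pos.2 hp).ne'
  have hfreq := infinitePi_ae_frequently_eq _ htop
  -- A union over k would cost too much. The event that all large k are bad is an increasing union
  -- over N of subsets of single bad events, so it costs only 12/n.
  set bad : Set (ℤ → SimpleGraph (Fin n)) := {G | ∀ᶠ k : ℕ in atTop, BadRun L x₀ k G} with hbad
  have hbadm : dynamicER n p bad ≤ ENNReal.ofReal (12 / n) := by
    have h1 : bad = ⋃ N : ℕ, {G | ∀ k ≥ N, BadRun L x₀ k G} := by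
      ext G
      simp [hbad, eventually_atTop]
    have h2 : Monotone fun N : ℕ => {G : ℤ → SimpleGraph (Fin n) | ∀ k ≥ N, BadRun L x₀ k G} :=
      fun N M h G hG k hk => hG k (h.trans hk)
    rw [h1, h2.measure_iUnion]
    refine iSup_le fun N => ?_
    rw [← ENNReal.ofReal_toReal (measure_ne_top (dynamicER n p) _)]
    exact ENNReal.ofReal_le_ofReal ((measureReal_mono (s₂ := {G | BadRun L x₀ N G})
      fun G (hG : ∀ k ≥ N, BadRun L x₀ k G) => hG N le_rfl).trans
      (measureReal_badRun hn hL hlog x₀ N))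
  have hsub : {G : ℤ → SimpleGraph (Fin n) |
      (∀ t : ℤ, TargetExists (fun s => lazyWalk (G s)) t) ∧ ∀ t ∈ Set.Icc (0 : ℤ) n,
        ((c ^ 2 : ℝ) : EReal) ≤ Theta (fun s => lazyWalk (G s)) t}ᶜ ⊆
      bad ∪ {G | ¬ ∃ᶠ u in atBot, G u = ⊤} := by
    intro G hG
    by_contra hcon
    simp only [hbad, Set.mem_union, Set.mem_ofPred_eq, not_or, not_not, not_eventually] at hcon
    obtain ⟨hgood, hcomp⟩ := hcon
    refine hG ?_
    have hex : ∀ t, TargetExists (fun s => lazyWalk (G s)) t := by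
      refine targetExists_of_frequently_positive (fun u => lazyWalk_nonneg (G u))
        (fun u => lazyWalk_sum (G u)) (ε := 1 / (2 * n)) (by positivity) (hcomp.mono ?_)
      intro u hu x y
      have h1 := le_lazyWalk_of_complete (G u) (fun x y hxy => by rw [hu]; exact hxy) x y
      rwa [Fintype.card_fin] at h1
    have hgood' : ∃ᶠ k : ℕ in atTop, n ≤ k ∧ ¬ BadRun L x₀ k G :=
      (hgood.and_eventually (eventually_ge_atTop n)).mono fun k hk => ⟨hk.2, hk.1⟩
    refine ⟨hex, fun t ht => le_Theta (by omega) hL0 hex ?_ ?_ hc0 hc ht⟩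
    · intro s hs
      obtain ⟨k, -, hk⟩ := hgood'.exists
      simp only [BadRun, not_exists, not_or] at hk
      have h1 := (hk ⟨(s - 1 + n).toNat, by have := hs.1; have := hs.2; omega⟩).1
      have h2 : -(n : ℤ) + ((s - 1 + n).toNat : ℤ) + 1 = s := by have := hs.1; omega
      rw [not_not, h2] at h1
      exact h1
    · intro s hs
      refine target_mem_Icc_of_frequently (hex s) x₀ ?_
      have h1 : Tendsto (fun k : ℕ => -(k : ℤ)) atTop atBot :=
        tendsto_neg_atTop_atBot.comp tendsto_natCast_atTop_atTop
      exact h1.frequently (hgood'.mono fun k hk =>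
        transitionProd_mem_Icc_of_not_badRun hL0 hgeo hk.1 hk.2 hs)
  have hcompl : dynamicER n p {G : ℤ → SimpleGraph (Fin n) |
      (∀ t : ℤ, TargetExists (fun s => lazyWalk (G s)) t) ∧ ∀ t ∈ Set.Icc (0 : ℤ) n,
        ((c ^ 2 : ℝ) : EReal) ≤ Theta (fun s => lazyWalk (G s)) t}ᶜ ≤
      ENNReal.ofReal (12 / n) := by
    refine (measure_mono hsub).trans ((measure_union_le _ _).trans ?_)
    have h1 : dynamicER n p {G | ¬ ∃ᶠ u in atBot, G u = ⊤} = 0 := ae_iff.1 hfreq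
    rw [h1, add_zero]
    exact hbadm
  -- Subadditivity suffices here, so the event need not be shown measurable.
  rw [tsub_le_iff_right]
  calc (1 : ENNReal) = dynamicER n p Set.univ := measure_univ.symm
    _ ≤ _ := measure_univ_le_add_compl _
    _ ≤ _ := add_le_add_right hcompl _

end Runs

end DynamicGraph

/-! ### The limit n → ∞ -/

theorem mainTheorem5 (η : ℝ) (hη : 50 < η) (p : ℕ → unitInterval)
    (hp : ∀ᶠ n : ℕ in atTop, (p n : ℝ) = η * Real.log n / ((n : ℝ) - 1))
    (α₁ α₂ : ℝ) (hα₁ : α₁ = 0.002) (hα₂ : α₂ = 7) :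
    Tendsto
      (fun n : ℕ => DynamicGraph.dynamicER n (p n)
        {G : ℤ → SimpleGraph (Fin n) |
          (∀ t : ℤ, DynamicGraph.TargetExists (fun s => DynamicGraph.lazyWalk (G s)) t) ∧
          ∀ t ∈ Set.Icc (0 : ℤ) (n : ℤ),
            (((α₁ / (2 * α₂ - α₁) * (α₁ / (32 * α₂ ^ 2))) ^ 2 : ℝ) : EReal) ≤
              DynamicGraph.Theta (fun s => DynamicGraph.lazyWalk (G s)) t})
      atTop (𝓝 1) := by
  have hgeo : ∀ᶠ n : ℕ in atTop, (n : ℝ) * 0.9 ^ (n - 1) ≤ 7 := by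
    have h1 := tendsto_self_mul_const_pow_of_lt_one (r := (0.9 : ℝ)) (by norm_num) (by norm_num)
    filter_upwards [h1.eventually_le_const (show (0 : ℝ) < 6 by norm_num),
      eventually_ge_atTop 1] with n hn hn1
    obtain ⟨m, rfl⟩ := Nat.exists_eq_add_of_le' hn1
    rw [pow_succ] at hn
    rw [Nat.add_sub_cancel]
    linarith
  have hlt : ∀ᶠ n : ℕ in atTop, η * Real.log n / ((n : ℝ) - 1) < 1 := by
    have h1 : Tendsto (fun n : ℕ => Real.log n / (n : ℝ)) atTop (𝓝 0) :=
      Real.isLittleO_log_id_atTop.tendsto_div_nhds_zero.comp tendsto_natCast_atTop_atTop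
    have h2 := h1.const_mul η
    rw [mul_zero] at h2
    filter_upwards [h2.eventually_lt_const (show (0 : ℝ) < 1 / 2 by norm_num),
      eventually_ge_atTop 3] with n hn hn3
    have hn' : (3 : ℝ) ≤ n := by exact_mod_cast hn3
    rw [← mul_div_assoc, div_lt_iff₀ (by linarith)] at hn
    rw [div_lt_one (by linarith)]
    linarith
  have hlim : Tendsto (fun n : ℕ => 1 - ENNReal.ofReal (12 / n)) atTop (𝓝 1) := by
    have h1 : Tendsto (fun n : ℕ => ENNReal.ofReal (12 / n)) atTop (𝓝 0) := by
      have := ENNReal.tendsto_ofReal (tendsto_const_div_atTop_nhds_zero_nat (12 : ℝ))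
      simpa using this
    have := ENNReal.Tendsto.sub (tendsto_const_nhds (x := (1 : ENNReal))) h1 (by simp)
    simpa using this
  refine tendsto_of_tendsto_of_tendsto_of_le_of_le' hlim tendsto_const_nhds ?_
    (Eventually.of_forall fun n => prob_le_one)
  filter_upwards [hp, hgeo, hlt, eventually_ge_atTop 400] with n hpn hgn hln hn
  have hn' : (400 : ℝ) ≤ n := by exact_mod_cast hn
  have hlog : 0 ≤ Real.log n := Real.log_nonneg (by linarith)
  refine DynamicGraph.le_dynamicER_Theta (L := η * Real.log n) hn ?_
    (mul_le_mul_of_nonneg_right hη.le hlog) (hpn.trans_lt hln) hgn ?_ ?_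
  · rw [hpn, div_mul_cancel₀ _ (by linarith)]
  · rw [hα₁, hα₂]
    norm_num
  · rw [hα₁, hα₂]
    norm_num
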